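/- Let $T\ge 2$ and $\mathcal T=\{1,\dots,T\}$. For $\alpha\ge 0$ and $i,t\in\mathcal T$ let $$C^{\alpha}_{i,t}=\sum_{k=1}^{M^{\alpha}_i}Z_{i,k}I\{D_{i,k}\le t\},$$ where $M^\alpha_i$ are $\{0,1,2,\dots\}$-valued, $D_{i,k}$ are $\mathcal T$-valued and $Z_{i,k}$ are real-valued random variables on one probability space such that the following general model holds. (GM1) For each $i\in\mathcal T$ the sequence $(D_{i,k},Z_{i,k})_{k\ge1}$ is i.i.d., with a common distribution that does not depend on $i$; for a generic pair $(D,Z)$ with this distribution, $\operatorname{E}[Z^2]<\infty$ and $\operatorname{E}[ZI\{D=t\}]>0$ for each $t\in\mathcal T$. (GM2) For each $i\in\mathcal T$ and each $\alpha$, $(D_{i,k},Z_{i,k})_{k\ge1}$ and $M^\alpha_i$ are independent. (GM3) For each $\alpha$, $\{M^\alpha_1,(D_{1,k},Z_{1,k})_{k\ge1}\},\dots,\{M^\alpha_T,(D_{T,k},Z_{T,k})_{k\ge1}\}$ are independent. (GM4) For each $i\in\mathcal T$ there is $\lambda_i\in(0,\infty)$ with $M^\alpha_i/\alpha\to\lambda_i$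 a.s. as $\alpha\to\infty$. For $1\le t\le T-1$ put $$f_t=\frac{\operatorname{E}[ZI\{D\le t+1\}]}{\operatorname{E}[ZI\{D\le t\}]},\qquad \widehat f_t=\frac{\sum_{j=1}^{T-t}C^\alpha_{j,t+1}}{\sum_{j=1}^{T-t}C^\alpha_{j,t}},$$ $$\sigma_t^2=(f_t-1)\bigg(\frac{\operatorname{E}[Z^2I\{D=t+1\}]}{\operatorname{E}[ZI\{D=t+1\}]}+(f_t-1)\frac{\operatorname{E}[Z^2I\{D\le t\}]}{\operatorname{E}[ZI\{D\le t\}]}\bigg).$$ For $1\le t\le T-2$ put $\widehat\sigma_t^2=\frac1{T-t-1}\sum_{j=1}^{T-t}C^\alpha_{j,t}\big(C^\alpha_{j,t+1}/C^\alpha_{j,t}-\widehat f_t\big)^2$, and let $\widehat\sigma_{T-1}^2$ be any chosen estimate of $\sigma_{T-1}^2$. Then for each $i\in\mathcal T$ with $i\ge2$ the following hold. (a) There exists $\gamma_i\in(0,\infty)$ such that, as $\alpha\to\infty$, $$C^{\alpha}_{i,T-i+1}\bigg(\prod_{s=T-i+1}^{T-1}f_s-\prod_{s=T-i+1}^{T-1}\widehat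 f_s\bigg)^2\stackrel{d}{\to}\gamma_i^2\chi^2_1,$$ where $\chi^2_1$ has the chi-squared distribution with one degree of freedom. (b) If $Z$ and $D$ are independent, then $$\gamma_i^2=\lambda_i\operatorname{E}[ZI\{D\le T-i+1\}]\prod_{s=T-i+1}^{T-1}f_s^2\sum_{t=T-i+1}^{T-1}\frac{\sigma_t^2/f_t^2}{\sum_{j=1}^{T-t}\lambda_j\operatorname{E}[ZI\{D\le t\}]}.$$ (c) Let $\alpha>0$ and let $\widehat\gamma_i^2$ be the plug-in version of the formula in (b), obtained by replacing $f_t$ by $\widehat f_t$, $\sigma_t^2$ by $\widehat\sigma_t^2$ and $\lambda_j\operatorname{E}[ZI\{D\le t\}]$ by $\alpha^{-1}C^\alpha_{j,t}$. Then the resulting estimator $C^\alpha_{i,T-i+1}\widehat\gamma_i^2$ of $(C^\alpha_{i,T-i+1})^2\big(\prod_{s=T-i+1}^{T-1} f_s-\prod_{s=T-i+1}^{T-1}\widehat f_s\big)^2$ equals Mack's estimator of the estimation error, $$(\widehat C^\alpha_{i,T})^2\sum_{t=T-i+1}^{T-1}\frac{\widehat\sigma_t^2}{\widehat f_t^2}\,\frac{1}{\sum_{j=1}^{T-t}C^\alpha_{j,t}},\qquad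 \widehat C^\alpha_{i,T}=C^\alpha_{i,T-i+1}\prod_{s=T-i+1}^{T-1}\widehat f_s .$$ -/

import Mathlib

open MeasureTheory ProbabilityTheory Filter Topology
open scoped NNReal

noncomputable section

namespace ChainLadder

/-! Accident years `i`, `j` and development years `t` are 1-based natural numbers in `{1, …, T}`. -/

/-- The chi-squared distribution with `n` degrees of freedom: the law of the sum of the squares of
`n` independent standard normal random variables. -/
def chiSquared (n : ℕ) : Measure ℝ :=
  (Measure.pi (fun _ : Fin n => gaussianReal 0 1)).map (fun x => ∑ k, x k ^ 2)

instance (n : ℕ) : IsProbabilityMeasure (chiSquared n) :=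
  Measure.isProbabilityMeasure_map (Measurable.aemeasurable (by fun_prop))

/-- `E[Z ^ n * 1{D ∈ A}]`, where `ν` is the law of the generic pair `(D, Z)`. -/
def claimMoment (ν : Measure (ℕ × ℝ)) (n : ℕ) (A : Set ℕ) : ℝ :=
  ∫ p, A.indicator (fun _ => p.2 ^ n) p.1 ∂ν

/-- The development factor `f_t = E[Z 1{D ≤ t + 1}] / E[Z 1{D ≤ t}]`. -/
def devFactor (ν : Measure (ℕ × ℝ)) (t : ℕ) : ℝ :=
  claimMoment ν 1 (Set.Iic (t + 1)) / claimMoment ν 1 (Set.Iic t)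

/-- The parameter `σ_t ^ 2`. -/
def sigmaSq (ν : Measure (ℕ × ℝ)) (t : ℕ) : ℝ :=
  (devFactor ν t - 1) *
    (claimMoment ν 2 {t + 1} / claimMoment ν 1 {t + 1} +
      (devFactor ν t - 1) * (claimMoment ν 2 (Set.Iic t) / claimMoment ν 1 (Set.Iic t)))

/-- The accumulated claims amount `C_{i,t} = ∑_{k ≤ M_i} Z_{i,k} 1{D_{i,k} ≤ t}` at exposure `α`
(the claims of an accident year are numbered from `0`). -/
def cumClaims {Ω : Type*} (M : ℕ → ℝ≥0 → Ω → ℕ) (D : ℕ → ℕ → Ω → ℕ) (Z : ℕ → ℕ → Ω → ℝ)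
    (α : ℝ≥0) (ω : Ω) (i t : ℕ) : ℝ :=
  ∑ k ∈ Finset.range (M i α ω), if D i k ω ≤ t then Z i k ω else 0

/-- The general model with `T` accident years and `T` development years: `M i α` is the number of
accident events in accident year `i` at exposure `α ≥ 0`, with asymptotic intensity `lam i`;
`Z i k` and `D i k` are the size and the development year of the `k`-th claim of accident year `i`,
and `ν` is the law of the generic pair `(D, Z)`. -/
structure GeneralModel {Ω : Type*} [MeasurableSpace Ω] (P : Measure Ω) (T : ℕ)
    (M : ℕ → ℝ≥0 → Ω → ℕ) (D : ℕ → ℕ → Ω → ℕ) (Z : ℕ → ℕ → Ω → ℝ)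
    (ν : Measure (ℕ × ℝ)) (lam : ℕ → ℝ) : Prop where
  measurable_M : ∀ i ∈ Finset.Icc 1 T, ∀ α, Measurable (M i α)
  measurable_D : ∀ i ∈ Finset.Icc 1 T, ∀ k, Measurable (D i k)
  measurable_Z : ∀ i ∈ Finset.Icc 1 T, ∀ k, Measurable (Z i k)
  /-- Development years lie in `{1, …, T}`. -/
  dev_mem : ∀ᵐ p ∂ν, p.1 ∈ Finset.Icc 1 T
  /-- For each accident year the pairs `(D i k, Z i k)` are independent … -/
  indep_claims : ∀ i ∈ Finset.Icc 1 T, iIndepFun (fun k ω => (D i k ω, Z i k ω)) P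
  /-- … with a common law that does not depend on the accident year, … -/
  law_claims : ∀ i ∈ Finset.Icc 1 T, ∀ k, HasLaw (fun ω => (D i k ω, Z i k ω)) ν P
  /-- … `E[Z ^ 2] < ∞` … -/
  sq_integrable : MemLp Prod.snd 2 ν
  /-- … and `E[Z 1{D = t}] > 0`. -/
  mean_pos : ∀ t ∈ Finset.Icc 1 T, 0 < claimMoment ν 1 {t}
  /-- Numbers of accidents and claims data of one accident year are independent, -/
  indep_count : ∀ i ∈ Finset.Icc 1 T, ∀ α,
    IndepFun (fun ω k => (D i k ω, Z i k ω)) (M i α) P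
  /-- and different accident years are independent. -/
  indep_years : ∀ α,
    iIndepFun (fun (i : Finset.Icc 1 T) ω => (M i α ω, fun k : ℕ => (D i k ω, Z i k ω))) P
  lam_pos : ∀ i ∈ Finset.Icc 1 T, 0 < lam i
  tendsto_count : ∀ i ∈ Finset.Icc 1 T,
    ∀ᵐ ω ∂P, Tendsto (fun α : ℝ≥0 => (M i α ω : ℝ) / (α : ℝ)) atTop (𝓝 (lam i))

/-- The chain ladder estimator of `f_t` from the array `c j t` of accumulated claims amounts. -/
def fHat (T : ℕ) (c : ℕ → ℕ → ℝ) (t : ℕ) : ℝ :=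
  (∑ j ∈ Finset.Icc 1 (T - t), c j (t + 1)) / ∑ j ∈ Finset.Icc 1 (T - t), c j t

/-- The estimator of `σ_t ^ 2` for `t ≤ T - 2`. The defining formula makes no sense for
`t = T - 1`, where the estimate has to be supplied separately: it is the argument `last`. -/
def sigmaHatSq (T : ℕ) (c : ℕ → ℕ → ℝ) (last : ℝ) (t : ℕ) : ℝ :=
  if t + 2 ≤ T then
    1 / ((T : ℝ) - t - 1) *
      ∑ j ∈ Finset.Icc 1 (T - t), c j t * (c j (t + 1) / c j t - fHat T c t) ^ 2
  else last

/-- The variance formula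
`m_{i,T-i+1} ∏_{s=T-i+1}^{T-1} f_s ^ 2 ∑_{t=T-i+1}^{T-1} (v_t / f_t ^ 2) / ∑_{j=1}^{T-t} m_{j,t}`
as a function of its arguments `m`, `f`, `v`. -/
def gammaSqFormula (T i : ℕ) (m : ℕ → ℕ → ℝ) (f v : ℕ → ℝ) : ℝ :=
  m i (T - i + 1) * (∏ s ∈ Finset.Icc (T - i + 1) (T - 1), f s ^ 2) *
    ∑ t ∈ Finset.Icc (T - i + 1) (T - 1), (v t / f t ^ 2) / ∑ j ∈ Finset.Icc 1 (T - t), m j t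

/-- The chain ladder predictor of the ultimate claims amount of accident year `i`. -/
def ultimatePredictor (T : ℕ) (c : ℕ → ℕ → ℝ) (i : ℕ) : ℝ :=
  c i (T - i + 1) * ∏ s ∈ Finset.Icc (T - i + 1) (T - 1), fHat T c s

/-- Mack's estimator of the estimation error of accident year `i`, i.e. the part
`Ĉ_{i,T} ^ 2 ∑_t (σ̂_t ^ 2 / f̂_t ^ 2) (1 / ∑_{j=1}^{T-t} C_{j,t})` of his estimator of the
conditional mean squared error of prediction. -/
def mackEstimationError (T : ℕ) (c : ℕ → ℕ → ℝ) (last : ℝ) (i : ℕ) : ℝ :=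
  ultimatePredictor T c i ^ 2 *
    ∑ t ∈ Finset.Icc (T - i + 1) (T - 1),
      sigmaHatSq T c last t / fHat T c t ^ 2 * (1 / ∑ j ∈ Finset.Icc 1 (T - t), c j t)

end ChainLadder

end

/-! Replacing the factors `f_t` by their estimates one at a time writes the error of the product
exactly as a sum over `t` of `∑_j (C_{j,t+1} - f_t C_{j,t})` times the random weight `deltaWeight`
(`prod_fHat_sub_prod`). Each inner sum runs over individual claims, with summand `residual ν t`,
which is centred precisely because of the choice of `f_t`.

Two limit theorems then apply. The strong law at the random index `M` makes `α * deltaWeight`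
converge almost surely to `limitWeight`. The central limit theorem for randomly stopped sums
(`tendstoInDistribution_sum_claimSum`) comes from characteristic functions: given `M`, that of the
scaled sum is `φ(t / √α) ^ M`, and `M / α → λ`. By Slutsky's theorem the weights may be replaced by
their limits. Regrouped by accident years, which are independent, the main term is a single sum of
`influence`, so `√α` times the error is asymptotically normal with variance `V = ∑_j λ_j
E[influence_j ^ 2]`. As `C_{i,n} / α` converges to a constant `c`, the squared error multiplied by
`C_{i,n}` tends to `c V χ²_1`. Claims with `D = T` force `V > 0`.

If `Z` and `D` are independent, `E[Z ^ 2 1{D ≤ t}]` grows by the same factors `f_t` as `E[Z 1{D ≤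
t}]`. This makes residuals of different `t` orthogonal, so only the diagonal terms of `V` remain.
The identity with Mack's estimator is the cancellation of `α`. -/

noncomputable section

namespace ChainLadder

/-! ### Powers of characteristic functions -/

/-- Second order Taylor expansion at `0` of the characteristic function of a centered law. -/
lemma charFun_sub_isLittleO {μ : Measure ℝ} [IsProbabilityMeasure μ] (h2 : MemLp id 2 μ)
    (h0 : ∫ x, x ∂μ = 0) :
    (fun t : ℝ => charFun μ t - (1 - ((∫ x, x ^ 2 ∂μ : ℝ) : ℂ) * t ^ 2 / 2))
      =o[𝓝 0] fun t : ℝ => t ^ 2 := by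
  have h := taylor_isLittleO_univ (n := 2) (x₀ := (0 : ℝ)) (contDiff_charFun (by exact_mod_cast h2))
  refine (h.congr' ?_ ?_)
  · refine Eventually.of_forall fun t => ?_
    dsimp only
    rw [taylorWithinEval_charFun_zero (by exact_mod_cast h2)]
    simp only [Finset.sum_range_succ, Finset.range_zero, Finset.sum_empty, pow_zero, pow_one,
      integral_const, probReal_univ, h0]
    simp only [Nat.factorial, mul_pow, Complex.I_sq]
    push_cast
    simp
    ring
  · exact Eventually.of_forall fun t => by simp

/-- The characteristic function of a sum of `N α ∼ l α` centered independent identically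
distributed variables, scaled by `α ^ (-1/2)`, tends to that of a Gaussian. -/
lemma tendsto_charFun_pow {μ : Measure ℝ} [IsProbabilityMeasure μ] (h2 : MemLp id 2 μ)
    (h0 : ∫ x, x ∂μ = 0) {N : ℝ≥0 → ℕ} {l : ℝ}
    (hN : Tendsto (fun α : ℝ≥0 => (N α : ℝ) / (α : ℝ)) atTop (𝓝 l)) (t : ℝ) :
    Tendsto (fun α : ℝ≥0 => charFun μ ((√(α : ℝ))⁻¹ * t) ^ N α) atTop
      (𝓝 (Complex.exp (-((l * (∫ x, x ^ 2 ∂μ) * t ^ 2 / 2 : ℝ) : ℂ)))) := by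
  set v := ∫ x, x ^ 2 ∂μ with hv
  have harg : Tendsto (fun x : ℝ => (√x)⁻¹ * t) atTop (𝓝 0) := by
    rw [← zero_mul t]
    exact (tendsto_inv_atTop_zero.comp Real.tendsto_sqrt_atTop).mul_const t
  -- The Taylor expansion at `t / √x`, multiplied by `x`. It gives the limit of `x * log φ(t / √x)`,
  -- and multiplying by `N α / α → l` gives that of `N α * log φ`.
  have hg : Tendsto (fun x : ℝ => (x : ℂ) * (charFun μ ((√x)⁻¹ * t) - 1)) atTop
      (𝓝 (-((v * t ^ 2 / 2 : ℝ) : ℂ))) := by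
    have h := (charFun_sub_isLittleO h2 h0).comp_tendsto harg
    have h' : (fun x : ℝ => charFun μ ((√x)⁻¹ * t) - 1 + (x⁻¹ : ℝ) * ((v * t ^ 2 / 2 : ℝ) : ℂ))
        =o[atTop] fun x : ℝ => x⁻¹ := by
      have h3 : (fun x : ℝ => ((√x)⁻¹ * t) ^ 2) =O[atTop] fun x : ℝ => x⁻¹ := by
        refine Asymptotics.IsBigO.of_bound (t ^ 2) ?_
        filter_upwards [eventually_gt_atTop 0] with x hx
        rw [mul_pow, inv_pow, Real.sq_sqrt hx.le, norm_mul, mul_comm]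
        simp
      refine (h.trans_isBigO h3).congr' ?_ EventuallyEq.rfl
      filter_upwards [eventually_gt_atTop 0] with x hx
      have hs : (√x) ^ 2 = x := Real.sq_sqrt hx.le
      have hs' : (((√x)⁻¹ * t : ℝ) : ℂ) ^ 2 = ((x⁻¹ * t ^ 2 : ℝ) : ℂ) := by
        rw [← Complex.ofReal_pow, mul_pow, inv_pow, hs]
      simp only [Function.comp_apply, hs', ← hv]
      push_cast
      ring
    have h4 := h'.tendsto_inv_smul_nhds_zero
    rw [← zero_add (-_)]
    refine ((h4.add_const (-((v * t ^ 2 / 2 : ℝ) : ℂ)))).congr' ?_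
    filter_upwards [eventually_gt_atTop 0] with x hx
    have hx' : (x : ℂ) ≠ 0 := by exact_mod_cast hx.ne'
    simp only [inv_inv, Complex.real_smul]
    push_cast
    field_simp
    ring
  have hlog := (Complex.tendsto_mul_log_one_add_of_tendsto hg).comp
    (NNReal.tendsto_coe_atTop.2 tendsto_id)
  have hNc : Tendsto (fun α : ℝ≥0 => (((N α : ℝ) / (α : ℝ) : ℝ) : ℂ)) atTop (𝓝 (l : ℂ)) :=
    (Complex.continuous_ofReal.tendsto _).comp hN
  have hexp := (Complex.continuous_exp.tendsto _).comp (hNc.mul hlog)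
  -- The identity `φ ^ N = exp (N * log φ)` needs `φ ≠ 0`, which holds near the origin.
  have hne : ∀ᶠ x : ℝ in atTop, charFun μ ((√x)⁻¹ * t) ≠ 0 := by
    have hc : Tendsto (fun x : ℝ => charFun μ ((√x)⁻¹ * t)) atTop (𝓝 1) := by
      have := (continuous_charFun (μ := μ)).tendsto 0
      rw [charFun_zero] at this
      simpa [Function.comp_def] using this.comp harg
    exact hc.eventually_ne one_ne_zero
  have hlim : (l : ℂ) * -((v * t ^ 2 / 2 : ℝ) : ℂ) = -((l * v * t ^ 2 / 2 : ℝ) : ℂ) := by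
    push_cast; ring
  rw [hlim] at hexp
  refine hexp.congr' ?_
  filter_upwards [NNReal.tendsto_coe_atTop.2 tendsto_id |>.eventually hne, eventually_gt_atTop 0]
    with α hα hpos
  have hα' : ((α : ℝ) : ℂ) ≠ 0 := by exact_mod_cast hpos.ne'
  simp only [Function.comp_apply, id, add_sub_cancel] at hα ⊢
  rw [← Complex.exp_log hα, ← Complex.exp_nat_mul, Complex.exp_log hα]
  congr 1
  push_cast
  field_simp

/-! ### Randomly stopped sums: characteristic function and strong law -/

section RandomSum

variable {Ω E : Type*} [MeasurableSpace Ω] [MeasurableSpace E] {P : Measure Ω}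
  [IsProbabilityMeasure P]

lemma measurable_sum_range {g : E → ℝ} (hg : Measurable g) :
    Measurable (fun p : ℕ × (ℕ → E) => ∑ k ∈ Finset.range p.1, g (p.2 k)) := by
  refine measurable_from_prod_countable_right fun n => ?_
  exact Finset.measurable_fun_sum (Finset.range n) fun k _ => hg.comp (measurable_pi_apply k)

/-- The characteristic function of a randomly stopped sum. -/
lemma charFun_map_randomSum {Y : ℕ → Ω → E} {N : Ω → ℕ} {ν : Measure E} {g : E → ℝ}
    (hY : ∀ k, Measurable (Y k)) (hN : Measurable N) (hind : iIndepFun Y P)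
    (hlaw : ∀ k, HasLaw (Y k) ν P) (hYN : IndepFun (fun ω k => Y k ω) N P) (hg : Measurable g)
    (c t : ℝ) :
    charFun (P.map (fun ω => c * ∑ k ∈ Finset.range (N ω), g (Y k ω))) t =
      ∫ ω, charFun (ν.map g) (c * t) ^ N ω ∂P := by
  have hYm : Measurable (fun ω k => Y k ω) := measurable_pi_lambda _ hY
  have hsum : Measurable (fun ω => ∑ k ∈ Finset.range (N ω), g (Y k ω)) :=
    (measurable_sum_range hg).comp (hN.prodMk hYm)
  rw [charFun_map_mul_comp hsum.aemeasurable, charFun_apply_real,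
    integral_map hsum.aemeasurable (by fun_prop)]
  set F : ℕ × (ℕ → E) → ℂ := fun p =>
    Complex.exp (((c * t : ℝ) : ℂ) * ((∑ k ∈ Finset.range p.1, g (p.2 k) : ℝ) : ℂ) * Complex.I)
    with hF
  have hFm : Measurable F := by
    have := measurable_sum_range hg
    fun_prop
  -- Independence turns the joint law of count and claims into a product, so Fubini amounts to
  -- conditioning on the count.
  have hmap := (hYN.symm).map_prod_eq_prod_map_map hN.aemeasurable hYm.aemeasurable
  have := Measure.isProbabilityMeasure_map (μ := P) hYm.aemeasurable
  have := Measure.isProbabilityMeasure_map (μ := P) hN.aemeasurable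
  calc ∫ ω, Complex.exp (((c * t : ℝ) : ℂ) *
          ((∑ k ∈ Finset.range (N ω), g (Y k ω) : ℝ) : ℂ) * Complex.I) ∂P
      = ∫ p, F p ∂(P.map (fun ω => (N ω, fun k => Y k ω))) := by
        rw [integral_map (hN.prodMk hYm).aemeasurable hFm.aestronglyMeasurable]
    _ = ∫ n, ∫ y, F (n, y) ∂(P.map fun ω k => Y k ω) ∂(P.map N) := by
        rw [hmap, integral_prod]
        refine Integrable.of_bound hFm.aestronglyMeasurable 1 (ae_of_all _ fun p => ?_)
        rw [hF]
        dsimp only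
        rw [← Complex.ofReal_mul, Complex.norm_exp_ofReal_mul_I]
    _ = ∫ n, charFun (ν.map g) (c * t) ^ n ∂(P.map N) := by
        congr 1 with n
        have hi : iIndepFun (fun k ω => g (Y k ω)) P := hind.comp (fun _ => g) fun _ => hg
        have hc := congrFun (iIndepFun.charFun_map_fun_finsetSum_eq_prod (s := Finset.range n)
          (X := fun k ω => g (Y k ω)) (P := P) (fun k _ => (hg.comp (hY k)).aemeasurable)
          (hi.restrict _)) (c * t)
        have hk : ∀ k, P.map (fun ω => g (Y k ω)) = ν.map g := fun k => by
          rw [← (hlaw k).map_eq, Measure.map_map hg (hY k)]; rfl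
        simp only [hk, Finset.prod_const, Finset.card_range, Pi.pow_apply] at hc
        have hsn : Measurable fun ω => ∑ k ∈ Finset.range n, g (Y k ω) :=
          Finset.measurable_fun_sum (Finset.range n) fun k _ => hg.comp (hY k)
        have hFn : Measurable fun y : ℕ → E => F (n, y) := hFm.comp measurable_prodMk_left
        rw [← hc, charFun_apply_real, integral_map hYm.aemeasurable hFn.aestronglyMeasurable,
          integral_map hsn.aemeasurable (by fun_prop)]
    _ = _ := by
        rw [integral_map hN.aemeasurable (by fun_prop)]

/-- The characteristic functions of a scaled randomly stopped sum of centered variables converge. -/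
lemma tendsto_charFun_map_randomSum {Y : ℕ → Ω → E} {N : ℝ≥0 → Ω → ℕ} {ν : Measure E}
    {g : E → ℝ} {l : ℝ}
    (hY : ∀ k, Measurable (Y k)) (hN : ∀ α, Measurable (N α)) (hind : iIndepFun Y P)
    (hlaw : ∀ k, HasLaw (Y k) ν P) (hYN : ∀ α, IndepFun (fun ω k => Y k ω) (N α) P)
    (hg : Measurable g) (h2 : MemLp g 2 ν) (h0 : ∫ p, g p ∂ν = 0)
    (hl : ∀ᵐ ω ∂P, Tendsto (fun α : ℝ≥0 => (N α ω : ℝ) / (α : ℝ)) atTop (𝓝 l)) (t : ℝ) :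
    Tendsto (fun α : ℝ≥0 => charFun
        (P.map (fun ω => (√(α : ℝ))⁻¹ * ∑ k ∈ Finset.range (N α ω), g (Y k ω))) t) atTop
      (𝓝 (Complex.exp (-((l * (∫ p, g p ^ 2 ∂ν) * t ^ 2 / 2 : ℝ) : ℂ)))) := by
  simp_rw [fun α => charFun_map_randomSum hY (hN α) hind hlaw (hYN α) hg]
  have : IsProbabilityMeasure ν := (hlaw 0).isProbabilityMeasure_iff.1 inferInstance
  have := Measure.isProbabilityMeasure_map (μ := ν) hg.aemeasurable
  have h2' : MemLp id 2 (ν.map g) := (memLp_map_measure_iff (by fun_prop) hg.aemeasurable).2 h2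
  have h0' : ∫ x, x ∂(ν.map g) = 0 := by rw [integral_map hg.aemeasurable (by fun_prop), h0]
  have hv : ∫ x, x ^ 2 ∂(ν.map g) = ∫ p, g p ^ 2 ∂ν :=
    integral_map hg.aemeasurable (by fun_prop)
  have hconst : Complex.exp (-((l * (∫ p, g p ^ 2 ∂ν) * t ^ 2 / 2 : ℝ) : ℂ)) =
      ∫ _, Complex.exp (-((l * (∫ p, g p ^ 2 ∂ν) * t ^ 2 / 2 : ℝ) : ℂ)) ∂P := by simp
  rw [hconst]
  refine tendsto_integral_filter_of_dominated_convergence (fun _ => 1) ?_ ?_ (by simp) ?_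
  · refine Eventually.of_forall fun α => Measurable.aestronglyMeasurable ?_
    exact (measurable_from_nat (f := fun n => charFun (ν.map g) ((√(α : ℝ))⁻¹ * t) ^ n)).comp (hN α)
  · refine Eventually.of_forall fun α => ae_of_all _ fun ω => ?_
    rw [norm_pow]
    exact pow_le_one₀ (norm_nonneg _) (norm_charFun_le_one _)
  · filter_upwards [hl] with ω hω
    rw [← hv]
    exact tendsto_charFun_pow h2' h0' hω t

omit [IsProbabilityMeasure P] in
/-- Strong law of large numbers for randomly stopped sums. -/
lemma tendsto_randomSum_div {Y : ℕ → Ω → E} {N : ℝ≥0 → Ω → ℕ} {ν : Measure E}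
    {g : E → ℝ} {l : ℝ} (hl0 : 0 < l) (hind : iIndepFun Y P)
    (hlaw : ∀ k, HasLaw (Y k) ν P) (hg : Measurable g) (hint : Integrable g ν)
    (hl : ∀ᵐ ω ∂P, Tendsto (fun α : ℝ≥0 => (N α ω : ℝ) / (α : ℝ)) atTop (𝓝 l)) :
    ∀ᵐ ω ∂P, Tendsto (fun α : ℝ≥0 => (∑ k ∈ Finset.range (N α ω), g (Y k ω)) / (α : ℝ)) atTop
      (𝓝 (l * ∫ p, g p ∂ν)) := by
  have hmp : ∀ k, P.map (Y k) = ν := fun k => (hlaw k).map_eq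
  have hslln := strong_law_ae_real (μ := P) (fun k ω => g (Y k ω))
    (by
      have : Integrable g (P.map (Y 0)) := by rwa [hmp]
      exact (integrable_map_measure (by rw [hmp]; exact hg.aestronglyMeasurable)
        (hlaw 0).aemeasurable).1 this)
    (fun j k hjk => (hind.indepFun hjk).comp hg hg)
    (fun k => (IdentDistrib.mk (hlaw k).aemeasurable (hlaw 0).aemeasurable
      (by rw [hmp, hmp])).comp hg)
  have hmean : ∫ ω, g (Y 0 ω) ∂P = ∫ p, g p ∂ν := by
    rw [← hmp 0, integral_map (hlaw 0).aemeasurable (by fun_prop)]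
  filter_upwards [hslln, hl] with ω h1 h2
  rw [hmean] at h1
  have hcoe : Tendsto (fun α : ℝ≥0 => (α : ℝ)) atTop atTop := NNReal.tendsto_coe_atTop.2 tendsto_id
  -- Here `l > 0` enters: the random index tends to infinity, so the strong law can be evaluated
  -- along it.
  have hNR : Tendsto (fun α : ℝ≥0 => (N α ω : ℝ)) atTop atTop := by
    refine (h2.pos_mul_atTop hl0 hcoe).congr' ?_
    filter_upwards [eventually_gt_atTop 0] with α hα
    have : (α : ℝ) ≠ 0 := by exact_mod_cast hα.ne'
    field_simp
  have hNN : Tendsto (fun α : ℝ≥0 => N α ω) atTop atTop := tendsto_natCast_atTop_iff.1 hNR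
  refine (h2.mul (h1.comp hNN)).congr' ?_
  filter_upwards [hNR.eventually_gt_atTop 0] with α hα
  simp only [Function.comp_apply]
  rw [div_mul_div_comm, mul_comm (N α ω : ℝ), mul_div_mul_right _ _ hα.ne']

end RandomSum

/-! ### Slutsky-type tools for a continuous parameter -/

section Slutsky

variable {Ω Ω' ι : Type*} [MeasurableSpace Ω] [MeasurableSpace Ω'] {P : Measure Ω} {P' : Measure Ω'}
  [IsProbabilityMeasure P] [IsProbabilityMeasure P'] {l : Filter ι}

/-- A limit along a countably generated filter can be tested on sequences; this brings the real
exposure `α` back to the sequential theorem. -/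
lemma tendstoInMeasure_of_ae_tendsto [l.IsCountablyGenerated] {X : ι → Ω → ℝ} {Z : Ω → ℝ}
    (hX : ∀ i, AEMeasurable (X i) P) (h : ∀ᵐ ω ∂P, Tendsto (fun i => X i ω) l (𝓝 (Z ω))) :
    TendstoInMeasure P X l Z := by
  intro ε hε
  refine tendsto_of_seq_tendsto fun u hu => ?_
  exact tendstoInMeasure_of_tendsto_ae (fun n => (hX (u n)).aestronglyMeasurable)
    (by filter_upwards [h] with ω hω using hω.comp hu) ε hε

/-- Portmanteau: the closed set `{ε ≤ ‖x‖}` is null for the limit law, hence so is its frontier, and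
its probabilities tend to `0`. -/
lemma tendstoInMeasure_zero_of_tendstoInDistribution {X : ι → Ω → ℝ} {Z : Ω' → ℝ}
    (h : TendstoInDistribution X l Z (fun _ => P) P') (hZ : ∀ x, Z x = 0) :
    TendstoInMeasure P X l 0 := by
  rw [tendstoInMeasure_iff_norm]
  intro ε hε
  have hcl : IsClosed {x : ℝ | ε ≤ ‖x‖} := isClosed_le continuous_const continuous_norm
  have hlim : (P'.map Z) {x : ℝ | ε ≤ ‖x‖} = 0 := by
    rw [Measure.map_apply_of_aemeasurable h.aemeasurable_limit hcl.measurableSet]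
    have : Z ⁻¹' {x : ℝ | ε ≤ ‖x‖} = ∅ := by
      ext x; simp [hZ, hε]
    rw [this, measure_empty]
  have hfr : (P'.map Z) (frontier {x : ℝ | ε ≤ ‖x‖}) = 0 :=
    measure_mono_null hcl.frontier_subset hlim
  have hten := ProbabilityMeasure.tendsto_measure_of_null_frontier_of_tendsto' h.tendsto
    (E := {x : ℝ | ε ≤ ‖x‖}) hfr
  simp only [ProbabilityMeasure.coe_mk, hlim] at hten
  refine hten.congr fun i => ?_
  rw [Measure.map_apply_of_aemeasurable (h.forall_aemeasurable i) hcl.measurableSet]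
  simp

/-- The product of a family that converges in distribution and one that converges to `0` in
probability converges to `0` in probability. -/
lemma tendstoInMeasure_mul_zero [l.IsCountablyGenerated] {X Y : ι → Ω → ℝ} {Z : Ω' → ℝ}
    (h : TendstoInDistribution X l Z (fun _ => P) P')
    (hY : TendstoInMeasure P Y l (fun _ => 0)) (hYm : ∀ i, AEMeasurable (Y i) P) :
    TendstoInMeasure P (fun i ω => X i ω * Y i ω) l 0 :=
  tendstoInMeasure_zero_of_tendstoInDistribution
    (h.continuous_comp_prodMk_of_tendstoInMeasure_const (g := fun p : ℝ × ℝ => p.1 * p.2)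
      (by fun_prop) hY hYm) (by simp)

omit [IsProbabilityMeasure P] in
lemma tendstoInMeasure_add {X Y : ι → Ω → ℝ} (hX : TendstoInMeasure P X l 0)
    (hY : TendstoInMeasure P Y l 0) : TendstoInMeasure P (fun i ω => X i ω + Y i ω) l 0 := by
  rw [tendstoInMeasure_iff_norm] at *
  intro ε hε
  have h := (hX (ε / 2) (by positivity)).add (hY (ε / 2) (by positivity))
  rw [add_zero] at h
  refine tendsto_of_tendsto_of_tendsto_of_le_of_le tendsto_const_nhds h (fun _ => zero_le) ?_
  intro i
  refine (measure_mono fun ω hω => ?_).trans (measure_union_le _ _)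
  simp only [Set.mem_ofPred_eq, Pi.zero_apply, sub_zero, Set.mem_union] at hω ⊢
  by_contra! hcon
  linarith [norm_add_le (X i ω) (Y i ω)]

omit [IsProbabilityMeasure P] in
lemma tendstoInMeasure_sum {κ : Type*} {X : κ → ι → Ω → ℝ} (s : Finset κ)
    (hX : ∀ k ∈ s, TendstoInMeasure P (X k) l 0) :
    TendstoInMeasure P (fun i ω => ∑ k ∈ s, X k i ω) l 0 := by
  classical
  induction s using Finset.induction_on with
  | empty =>
    rw [tendstoInMeasure_iff_norm]
    intro ε hε
    simpa [hε.not_ge] using tendsto_const_nhds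
  | insert a s ha ih =>
    simp only [Finset.sum_insert ha]
    exact tendstoInMeasure_add (hX a (by simp)) (ih fun k hk => hX k (by simp [hk]))

/-- Lévy's continuity theorem, applied along every sequence that tends to `l`. -/
lemma tendstoInDistribution_of_tendsto_charFun [l.IsCountablyGenerated] {X : ι → Ω → ℝ}
    {Z : Ω' → ℝ} (hX : ∀ i, AEMeasurable (X i) P) (hZ : AEMeasurable Z P')
    (h : ∀ t, Tendsto (fun i => charFun (P.map (X i)) t) l (𝓝 (charFun (P'.map Z) t))) :
    TendstoInDistribution X l Z (fun _ => P) P' where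
  forall_aemeasurable := hX
  aemeasurable_limit := hZ
  tendsto := by
    refine tendsto_of_seq_tendsto fun u hu => ?_
    exact ProbabilityMeasure.tendsto_iff_tendsto_charFun.2 fun t => (h t).comp hu

end Slutsky

/-! ### Residuals, moments and the telescoped product -/

/-- `Z * 1{D ≤ t}` as a function of the pair `(D, Z)`. -/
def payment (t : ℕ) (p : ℕ × ℝ) : ℝ := if p.1 ≤ t then p.2 else 0

/-- The part `Z * 1{D ≤ t + 1} - f_t * Z * 1{D ≤ t}` of a development that the factor `f_t` does
not explain. -/
def residual (ν : Measure (ℕ × ℝ)) (t : ℕ) (p : ℕ × ℝ) : ℝ :=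
  payment (t + 1) p - devFactor ν t * payment t p

/-- The sum of `g (D, Z)` over the claims of accident year `j`. -/
def claimSum {Ω : Type*} (M : ℕ → ℝ≥0 → Ω → ℕ) (D : ℕ → ℕ → Ω → ℕ) (Z : ℕ → ℕ → Ω → ℝ)
    (g : ℕ × ℝ → ℝ) (j : ℕ) (α : ℝ≥0) (ω : Ω) : ℝ :=
  ∑ k ∈ Finset.range (M j α ω), g (D j k ω, Z j k ω)

lemma measurable_payment (t : ℕ) : Measurable (payment t) :=
  Measurable.ite (measurable_fst measurableSet_Iic) measurable_snd measurable_const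

lemma measurable_residual (ν : Measure (ℕ × ℝ)) (t : ℕ) : Measurable (residual ν t) :=
  (measurable_payment _).sub ((measurable_payment t).const_mul _)

/-- The events `{D ≤ t}` are nested, so mixed second moments of payments reduce to `claimMoment ν
2`. -/
lemma payment_mul_payment (s t : ℕ) (p : ℕ × ℝ) :
    payment s p * payment t p = payment (min s t) p ^ 2 := by
  unfold payment
  by_cases hs : p.1 ≤ s <;> by_cases ht : p.1 ≤ t <;> simp [hs, ht, sq]

lemma claimMoment_one_Iic (ν : Measure (ℕ × ℝ)) (t : ℕ) :
    claimMoment ν 1 (Set.Iic t) = ∫ p, payment t p ∂ν := by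
  simp [claimMoment, payment, Set.indicator_apply]

lemma claimMoment_two_Iic (ν : Measure (ℕ × ℝ)) (t : ℕ) :
    claimMoment ν 2 (Set.Iic t) = ∫ p, payment t p ^ 2 ∂ν := by
  refine integral_congr_ae (ae_of_all _ fun p => ?_)
  by_cases h : p.1 ≤ t <;> simp [payment, h]

lemma claimMoment_Iic_succ {ν : Measure (ℕ × ℝ)} {n : ℕ} (hn : Integrable (fun p => p.2 ^ n) ν)
    (t : ℕ) :
    claimMoment ν n (Set.Iic (t + 1)) =
      claimMoment ν n (Set.Iic t) + claimMoment ν n {t + 1} := by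
  have hind : ∀ A : Set ℕ, Integrable (fun p : ℕ × ℝ => A.indicator (fun _ => p.2 ^ n) p.1) ν := by
    intro A
    refine (hn.indicator (measurable_fst (MeasurableSet.of_discrete (s := A)))).congr
      (ae_of_all _ fun p => rfl)
  unfold claimMoment
  rw [← integral_add (hind _) (hind _)]
  refine integral_congr_ae (ae_of_all _ fun p => ?_)
  rcases lt_trichotomy p.1 (t + 1) with h | h | h
  · simp [h.ne, h.le, Nat.lt_succ_iff.1 h]
  · simp [h]
  · simp [h.ne', h.not_ge, (Nat.lt_of_succ_lt h).not_ge]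

lemma claimSum_sub_mul {Ω : Type*} (M : ℕ → ℝ≥0 → Ω → ℕ) (D : ℕ → ℕ → Ω → ℕ)
    (Z : ℕ → ℕ → Ω → ℝ) (ν : Measure (ℕ × ℝ)) (t j : ℕ) (α : ℝ≥0) (ω : Ω) :
    claimSum M D Z (residual ν t) j α ω =
      cumClaims M D Z α ω j (t + 1) - devFactor ν t * cumClaims M D Z α ω j t := by
  simp only [claimSum, residual, cumClaims, payment, Finset.sum_sub_distrib, Finset.mul_sum]

/-- The factor of `∑_j (C_{j,t+1} - f_t C_{j,t})` in the telescoped difference between the product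
of the estimated and the product of the true development factors. -/
def deltaWeight (T : ℕ) (I : Finset ℕ) (f : ℕ → ℝ) (c : ℕ → ℕ → ℝ) (t : ℕ) : ℝ :=
  (∏ s ∈ I with s < t, fHat T c s) * (∏ s ∈ I with t < s, f s) / ∑ j ∈ Finset.Icc 1 (T - t), c j t

lemma prod_fHat_sub_prod (T : ℕ) (I : Finset ℕ) (f : ℕ → ℝ) (c : ℕ → ℕ → ℝ)
    (hc : ∀ t ∈ I, ∑ j ∈ Finset.Icc 1 (T - t), c j t ≠ 0) :
    ∏ s ∈ I, fHat T c s - ∏ s ∈ I, f s =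
      ∑ t ∈ I, (∑ j ∈ Finset.Icc 1 (T - t), (c j (t + 1) - f t * c j t)) *
        deltaWeight T I f c t := by
  -- Ordered expansion of `∏ (f + (fHat - f))`: at the replaced index `t`, estimates stand before
  -- and true factors after, as in `deltaWeight`.
  have h := Finset.prod_add_ordered I f (fun s => fHat T c s - f s)
  simp only [add_sub_cancel] at h
  rw [h, add_sub_cancel_left]
  refine Finset.sum_congr rfl fun t ht => ?_
  have hct := hc t ht
  rw [Finset.sum_sub_distrib, ← Finset.mul_sum]
  unfold deltaWeight
  rw [show fHat T c t - f t = (∑ j ∈ Finset.Icc 1 (T - t), c j (t + 1) -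
    f t * ∑ j ∈ Finset.Icc 1 (T - t), c j t) / ∑ j ∈ Finset.Icc 1 (T - t), c j t by
      unfold fHat; field_simp]
  ring

/-- The limit of the scaled weights `deltaWeight`. -/
def limitWeight (T : ℕ) (I : Finset ℕ) (ν : Measure (ℕ × ℝ)) (lam : ℕ → ℝ) (t : ℕ) : ℝ :=
  (∏ s ∈ I with s < t, devFactor ν s) * (∏ s ∈ I with t < s, devFactor ν s) /
    ∑ j ∈ Finset.Icc 1 (T - t), lam j * claimMoment ν 1 (Set.Iic t)

/-- The influence of a claim of accident year `j` on the product of the estimated development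
factors. -/
def influence (T : ℕ) (I : Finset ℕ) (ν : Measure (ℕ × ℝ)) (lam : ℕ → ℝ) (j : ℕ) (p : ℕ × ℝ) : ℝ :=
  ∑ t ∈ I, limitWeight T I ν lam t * if j ≤ T - t then residual ν t p else 0

/-! ### Limit theorems in the general model -/

namespace GeneralModel

variable {Ω : Type*} [MeasurableSpace Ω] {P : Measure Ω} [IsProbabilityMeasure P] {T : ℕ}
  {M : ℕ → ℝ≥0 → Ω → ℕ} {D : ℕ → ℕ → Ω → ℕ} {Z : ℕ → ℕ → Ω → ℝ}
  {ν : Measure (ℕ × ℝ)} {lam : ℕ → ℝ}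

lemma isProbabilityMeasure_law (h : GeneralModel P T M D Z ν lam) (hT : 1 ≤ T) :
    IsProbabilityMeasure ν :=
  (h.law_claims 1 (by simp [hT]) 0).isProbabilityMeasure_iff.1 inferInstance

omit [IsProbabilityMeasure P] in
lemma memLp_payment (h : GeneralModel P T M D Z ν lam) (t : ℕ) : MemLp (payment t) 2 ν := by
  refine h.sq_integrable.mono (measurable_payment t).aestronglyMeasurable (ae_of_all _ fun p => ?_)
  unfold payment
  split_ifs <;> simp

omit [IsProbabilityMeasure P] in
lemma memLp_residual (h : GeneralModel P T M D Z ν lam) (t : ℕ) : MemLp (residual ν t) 2 ν :=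
  (h.memLp_payment _).sub ((h.memLp_payment t).const_mul _)

lemma integrable_pow (h : GeneralModel P T M D Z ν lam) (hT : 1 ≤ T) {n : ℕ} (hn : n ≤ 2) :
    Integrable (fun p : ℕ × ℝ => p.2 ^ n) ν := by
  have := h.isProbabilityMeasure_law hT
  interval_cases n
  · simp
  · simpa using h.sq_integrable.integrable one_le_two
  · exact h.sq_integrable.integrable_sq

omit [IsProbabilityMeasure P] in
lemma claimMoment_Iic_zero (h : GeneralModel P T M D Z ν lam) :
    claimMoment ν 1 (Set.Iic 0) = 0 := by
  refine integral_eq_zero_of_ae ?_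
  filter_upwards [h.dev_mem] with p hp
  have : p.1 ≠ 0 := by simp at hp; omega
  simp [this]

lemma claimMoment_Iic_pos (h : GeneralModel P T M D Z ν lam) {t : ℕ} (h1 : 1 ≤ t) (hT : t ≤ T) :
    0 < claimMoment ν 1 (Set.Iic t) := by
  induction t, h1 using Nat.le_induction with
  | base =>
    -- Development years start at `1`, so `{D ≤ 1}` carries the same moment as `{D = 1}`.
    rw [claimMoment_Iic_succ (h.integrable_pow hT one_le_two) 0, h.claimMoment_Iic_zero]
    simpa using h.mean_pos 1 (by simp [hT])
  | succ t ht ih =>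
    rw [claimMoment_Iic_succ (h.integrable_pow (by omega) one_le_two) t]
    exact add_pos (ih (by omega)) (h.mean_pos _ (by simp [hT]))

lemma devFactor_pos (h : GeneralModel P T M D Z ν lam) {t : ℕ} (h1 : 1 ≤ t) (hT : t + 1 ≤ T) :
    0 < devFactor ν t :=
  div_pos (h.claimMoment_Iic_pos (by omega) hT) (h.claimMoment_Iic_pos h1 (by omega))

lemma sum_lam_mul_pos (h : GeneralModel P T M D Z ν lam) {t : ℕ} (h1 : 1 ≤ t) (hT : t + 1 ≤ T) :
    0 < ∑ j ∈ Finset.Icc 1 (T - t), lam j * claimMoment ν 1 (Set.Iic t) := by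
  refine Finset.sum_pos (fun j hj => ?_) ⟨1, by simp; omega⟩
  rw [Finset.mem_Icc] at hj
  exact mul_pos (h.lam_pos j (by simp; omega)) (h.claimMoment_Iic_pos h1 (by omega))

lemma integral_residual (h : GeneralModel P T M D Z ν lam) {t : ℕ} (h1 : 1 ≤ t)
    (hT : t + 1 ≤ T) : ∫ p, residual ν t p ∂ν = 0 := by
  have := h.isProbabilityMeasure_law (by omega)
  have hi := fun t => (h.memLp_payment t).integrable one_le_two
  unfold residual
  rw [integral_sub (hi _) ((hi t).const_mul _), integral_const_mul, ← claimMoment_one_Iic,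
    ← claimMoment_one_Iic]
  have := (h.claimMoment_Iic_pos h1 (by omega)).ne'
  unfold devFactor
  field_simp
  ring

omit [IsProbabilityMeasure P] in
lemma measurable_claimSum (h : GeneralModel P T M D Z ν lam) {j : ℕ} (hj : j ∈ Finset.Icc 1 T)
    (α : ℝ≥0) {g : ℕ × ℝ → ℝ} (hg : Measurable g) : Measurable (claimSum M D Z g j α) :=
  (measurable_sum_range hg).comp ((h.measurable_M j hj α).prodMk
    (measurable_pi_lambda _ fun k => (h.measurable_D j hj k).prodMk (h.measurable_Z j hj k)))

omit [IsProbabilityMeasure P] in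
lemma measurable_cumClaims (h : GeneralModel P T M D Z ν lam) {j : ℕ} (hj : j ∈ Finset.Icc 1 T)
    (α : ℝ≥0) (t : ℕ) : Measurable fun ω => cumClaims M D Z α ω j t :=
  h.measurable_claimSum hj α (measurable_payment t)

omit [IsProbabilityMeasure P] in
lemma measurable_sum_cumClaims (h : GeneralModel P T M D Z ν lam) (α : ℝ≥0) (n t : ℕ) :
    Measurable fun ω => ∑ j ∈ Finset.Icc 1 (T - n), cumClaims M D Z α ω j t := by
  refine Finset.measurable_fun_sum _ fun j hj => h.measurable_cumClaims ?_ α t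
  rw [Finset.mem_Icc] at hj ⊢
  omega

omit [IsProbabilityMeasure P] in
lemma measurable_fHat (h : GeneralModel P T M D Z ν lam) (α : ℝ≥0) (t : ℕ) :
    Measurable fun ω => fHat T (cumClaims M D Z α ω) t :=
  (h.measurable_sum_cumClaims α t (t + 1)).div (h.measurable_sum_cumClaims α t t)

omit [IsProbabilityMeasure P] in
lemma measurable_deltaWeight (h : GeneralModel P T M D Z ν lam) (α : ℝ≥0) (I : Finset ℕ)
    (f : ℕ → ℝ) (t : ℕ) :
    Measurable fun ω => deltaWeight T I f (cumClaims M D Z α ω) t :=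
  ((Finset.measurable_fun_prod _ fun s _ => h.measurable_fHat α s).mul_const _).div
    (h.measurable_sum_cumClaims α t t)

/-- The accumulated claims amounts grow linearly with the exposure. -/
lemma ae_tendsto_cumClaims_div (h : GeneralModel P T M D Z ν lam) :
    ∀ᵐ ω ∂P, ∀ j ∈ Finset.Icc 1 T, ∀ t, Tendsto
      (fun α : ℝ≥0 => cumClaims M D Z α ω j t / (α : ℝ)) atTop
      (𝓝 (lam j * claimMoment ν 1 (Set.Iic t))) := by
  refine (Filter.eventually_all_finset _).2 fun j hj => ?_
  rw [ae_all_iff]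
  intro t
  have : IsProbabilityMeasure ν := h.isProbabilityMeasure_law (by
    rw [Finset.mem_Icc] at hj; omega)
  rw [claimMoment_one_Iic]
  exact tendsto_randomSum_div (Y := fun k ω => (D j k ω, Z j k ω)) (N := M j) (g := payment t)
    (h.lam_pos j hj) (h.indep_claims j hj) (h.law_claims j hj)
    (measurable_payment t) ((h.memLp_payment t).integrable one_le_two) (h.tendsto_count j hj)

/-- The central limit theorem for sums over the claims of all accident years. -/
theorem tendstoInDistribution_sum_claimSum (h : GeneralModel P T M D Z ν lam)
    {g : ℕ → ℕ × ℝ → ℝ} (hg : ∀ j, Measurable (g j)) (h2 : ∀ j, MemLp (g j) 2 ν)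
    (h0 : ∀ j, ∫ p, g j p ∂ν = 0) :
    TendstoInDistribution
      (fun (α : ℝ≥0) ω => (√(α : ℝ))⁻¹ * ∑ j ∈ Finset.Icc 1 T, claimSum M D Z (g j) j α ω) atTop
      (fun x : ℝ => √(∑ j ∈ Finset.Icc 1 T, lam j * ∫ p, g j p ^ 2 ∂ν) * x) (fun _ => P)
      (gaussianReal 0 1) := by
  have hnn : 0 ≤ ∑ j ∈ Finset.Icc 1 T, lam j * ∫ p, g j p ^ 2 ∂ν :=
    Finset.sum_nonneg fun j hj => mul_nonneg (h.lam_pos j hj).le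
      (integral_nonneg fun p => sq_nonneg _)
  have hm : ∀ α : ℝ≥0, ∀ j ∈ Finset.Icc 1 T, Measurable
      (fun ω => (√(α : ℝ))⁻¹ * claimSum M D Z (g j) j α ω) := fun α j hj =>
    (h.measurable_claimSum hj α (hg j)).const_mul _
  simp_rw [Finset.mul_sum]
  refine tendstoInDistribution_of_tendsto_charFun
    (fun α => (Finset.measurable_fun_sum _ (hm α)).aemeasurable) (by fun_prop) fun t => ?_
  have hlim : charFun ((gaussianReal 0 1).map
      (fun x : ℝ => √(∑ j ∈ Finset.Icc 1 T, lam j * ∫ p, g j p ^ 2 ∂ν) * x)) t =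
      ∏ j ∈ Finset.Icc 1 T, Complex.exp (-((lam j * (∫ p, g j p ^ 2 ∂ν) * t ^ 2 / 2 : ℝ) : ℂ)) := by
    rw [charFun_map_mul, charFun_gaussianReal, ← Complex.exp_sum]
    congr 1
    have hs : ((√(∑ j ∈ Finset.Icc 1 T, lam j * ∫ p, g j p ^ 2 ∂ν) * t : ℝ) : ℂ) ^ 2 =
        ((∑ j ∈ Finset.Icc 1 T, lam j * ∫ p, g j p ^ 2 ∂ν : ℝ) : ℂ) * t ^ 2 := by
      rw [← Complex.ofReal_pow, mul_pow, Real.sq_sqrt hnn]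
      push_cast
      ring
    rw [hs, Finset.sum_neg_distrib, ← Complex.ofReal_sum, ← Finset.sum_div, ← Finset.sum_mul]
    push_cast
    simp
  rw [hlim]
  have hchar : ∀ α : ℝ≥0, charFun (P.map fun ω =>
      ∑ j ∈ Finset.Icc 1 T, (√(α : ℝ))⁻¹ * claimSum M D Z (g j) j α ω) t =
      ∏ j ∈ Finset.Icc 1 T,
        charFun (P.map fun ω => (√(α : ℝ))⁻¹ * claimSum M D Z (g j) j α ω) t := by
    intro α
    have hind : iIndepFun ((Finset.Icc 1 T).restrict
        fun j ω => (√(α : ℝ))⁻¹ * claimSum M D Z (g j) j α ω) P :=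
      (h.indep_years α).comp
        (fun j p => (√(α : ℝ))⁻¹ * ∑ k ∈ Finset.range p.1, g j (p.2 k))
        fun j => (measurable_sum_range (hg j)).const_mul _
    have := congrFun (hind.charFun_map_fun_finsetSum_eq_prod
      fun j hj => (hm α j hj).aemeasurable) t
    rw [this, Finset.prod_apply]
  simp_rw [hchar]
  refine tendsto_finsetProd _ fun j hj => ?_
  exact tendsto_charFun_map_randomSum (Y := fun k ω => (D j k ω, Z j k ω))
    (fun k => (h.measurable_D j hj k).prodMk (h.measurable_Z j hj k)) (h.measurable_M j hj)
    (h.indep_claims j hj) (h.law_claims j hj) (h.indep_count j hj) (hg j) (h2 j) (h0 j)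
    (h.tendsto_count j hj) t

end GeneralModel

/-! ### Asymptotic normality of the product and the chi-squared limit -/

lemma map_sq_gaussianReal_eq_map_chiSquared {c v : ℝ} (hc : 0 ≤ c) (hv : 0 ≤ v) :
    (gaussianReal 0 1).map (fun x : ℝ => c * (√v * x) ^ 2) =
      (chiSquared 1).map (fun x => √(c * v) ^ 2 * x) := by
  have he := (measurePreserving_eval (fun _ : Fin 1 => gaussianReal 0 1) 0).map_eq
  rw [chiSquared, Measure.map_map (by fun_prop) (by fun_prop)]
  nth_rewrite 1 [← he]
  rw [Measure.map_map (by fun_prop) (by fun_prop)]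
  congr 1
  ext x
  simp only [Function.comp_apply, Function.eval, Fin.sum_univ_one, mul_pow, Real.sq_sqrt hv,
    Real.sq_sqrt (mul_nonneg hc hv)]
  ring

lemma tendstoInDistribution_of_map_eq {Ω Ω' Ω'' ι : Type*} [MeasurableSpace Ω]
    [MeasurableSpace Ω'] [MeasurableSpace Ω''] {P : Measure Ω} {P' : Measure Ω'} {P'' : Measure Ω''}
    [IsProbabilityMeasure P] [IsProbabilityMeasure P'] [IsProbabilityMeasure P'']
    {l : Filter ι} {X : ι → Ω → ℝ} {Y : Ω' → ℝ} {W : Ω'' → ℝ}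
    (h : TendstoInDistribution X l Y (fun _ => P) P') (hW : AEMeasurable W P'')
    (hmap : P'.map Y = P''.map W) : TendstoInDistribution X l W (fun _ => P) P'' where
  forall_aemeasurable := h.forall_aemeasurable
  aemeasurable_limit := hW
  tendsto := by
    have := h.tendsto
    have heq : (⟨P''.map W, Measure.isProbabilityMeasure_map hW⟩ : ProbabilityMeasure ℝ) =
        ⟨P'.map Y, Measure.isProbabilityMeasure_map h.aemeasurable_limit⟩ :=
      Subtype.ext hmap.symm
    rwa [heq]

lemma sum_claimSum_influence {Ω : Type*} (M : ℕ → ℝ≥0 → Ω → ℕ) (D : ℕ → ℕ → Ω → ℕ)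
    (Z : ℕ → ℕ → Ω → ℝ) (T : ℕ) (I : Finset ℕ) (ν : Measure (ℕ × ℝ)) (lam : ℕ → ℝ)
    (α : ℝ≥0) (ω : Ω) :
    ∑ j ∈ Finset.Icc 1 T, claimSum M D Z (influence T I ν lam j) j α ω =
      ∑ t ∈ I, limitWeight T I ν lam t * ∑ j ∈ Finset.Icc 1 T,
        claimSum M D Z (fun p => if j ≤ T - t then residual ν t p else 0) j α ω := by
  simp only [claimSum, influence, Finset.mul_sum]
  rw [Finset.sum_comm]
  refine Finset.sum_congr rfl fun j _ => Finset.sum_comm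

/-- The estimate of `f_t` uses only accident years `j ≤ T - t`. Setting the summand to zero for
later years lets one central limit theorem over all years serve every `t`. -/
lemma sum_claimSum_ite {Ω : Type*} (M : ℕ → ℝ≥0 → Ω → ℕ) (D : ℕ → ℕ → Ω → ℕ)
    (Z : ℕ → ℕ → Ω → ℝ) (T : ℕ) (ν : Measure (ℕ × ℝ)) (t : ℕ) (α : ℝ≥0) (ω : Ω) :
    ∑ j ∈ Finset.Icc 1 T, claimSum M D Z (fun p => if j ≤ T - t then residual ν t p else 0) j α ω =
      ∑ j ∈ Finset.Icc 1 (T - t), (cumClaims M D Z α ω j (t + 1) -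
        devFactor ν t * cumClaims M D Z α ω j t) := by
  have hsub : Finset.Icc 1 (T - t) ⊆ Finset.Icc 1 T := Finset.Icc_subset_Icc le_rfl (by omega)
  rw [← Finset.sum_subset hsub]
  · refine Finset.sum_congr rfl fun j hj => ?_
    rw [← claimSum_sub_mul]
    simp [(Finset.mem_Icc.1 hj).2]
  · intro j hj hj'
    have : ¬ j ≤ T - t := fun hle => hj' (Finset.mem_Icc.2 ⟨(Finset.mem_Icc.1 hj).1, hle⟩)
    simp [claimSum, this]

namespace GeneralModel

variable {Ω : Type*} [MeasurableSpace Ω] {P : Measure Ω} [IsProbabilityMeasure P] {T : ℕ}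
  {M : ℕ → ℝ≥0 → Ω → ℕ} {D : ℕ → ℕ → Ω → ℕ} {Z : ℕ → ℕ → Ω → ℝ}
  {ν : Measure (ℕ × ℝ)} {lam : ℕ → ℝ} {I : Finset ℕ}

omit [IsProbabilityMeasure P] in
lemma measurable_influence (j : ℕ) : Measurable (influence T I ν lam j) := by
  refine Finset.measurable_fun_sum _ fun t _ => Measurable.const_mul ?_ _
  split_ifs
  exacts [measurable_residual ν t, measurable_const]

omit [IsProbabilityMeasure P] in
lemma memLp_influence (h : GeneralModel P T M D Z ν lam) (j : ℕ) :
    MemLp (influence T I ν lam j) 2 ν := by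
  refine memLp_finsetSum _ fun t _ => MemLp.const_mul ?_ _
  split_ifs
  exacts [h.memLp_residual t, MemLp.zero']

lemma integral_influence (h : GeneralModel P T M D Z ν lam) (hI : ∀ t ∈ I, 1 ≤ t ∧ t + 1 ≤ T)
    (j : ℕ) : ∫ p, influence T I ν lam j p ∂ν = 0 := by
  by_cases hT : 1 ≤ T
  · have := h.isProbabilityMeasure_law hT
    unfold influence
    rw [integral_finsetSum]
    · refine Finset.sum_eq_zero fun t ht => ?_
      rw [integral_const_mul]
      split_ifs
      · rw [h.integral_residual (hI t ht).1 (hI t ht).2, mul_zero]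
      · simp
    · intro t _
      refine Integrable.const_mul ?_ _
      split_ifs
      exacts [(h.memLp_residual t).integrable one_le_two, integrable_zero _ _ _]
  · have : I = ∅ := Finset.eq_empty_of_forall_notMem fun t ht => hT (by have := hI t ht; omega)
    simp [influence, this]

/-- Along almost every path the estimated development factors and the scaled weights converge. -/
lemma ae_tendsto_deltaWeight (h : GeneralModel P T M D Z ν lam)
    (hI : ∀ t ∈ I, 1 ≤ t ∧ t + 1 ≤ T) :
    ∀ᵐ ω ∂P, ∀ t ∈ I,
      (∀ᶠ α : ℝ≥0 in atTop, ∑ j ∈ Finset.Icc 1 (T - t), cumClaims M D Z α ω j t ≠ 0) ∧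
      Tendsto (fun α : ℝ≥0 => (α : ℝ) * deltaWeight T I (devFactor ν) (cumClaims M D Z α ω) t)
        atTop (𝓝 (limitWeight T I ν lam t)) := by
  filter_upwards [h.ae_tendsto_cumClaims_div] with ω hω
  have hsum : ∀ t ∈ I, ∀ s, Tendsto
      (fun α : ℝ≥0 => (∑ j ∈ Finset.Icc 1 (T - t), cumClaims M D Z α ω j s) / (α : ℝ)) atTop
      (𝓝 (∑ j ∈ Finset.Icc 1 (T - t), lam j * claimMoment ν 1 (Set.Iic s))) := by
    intro t ht s
    simp_rw [Finset.sum_div]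
    refine tendsto_finsetSum _ fun j hj => hω j ?_ s
    rw [Finset.mem_Icc] at hj ⊢
    omega
  have hpos : ∀ t ∈ I, (0 : ℝ) < ∑ j ∈ Finset.Icc 1 (T - t), lam j * claimMoment ν 1 (Set.Iic t) :=
    fun t ht => h.sum_lam_mul_pos (hI t ht).1 (hI t ht).2
  have hfhat : ∀ t ∈ I, Tendsto (fun α : ℝ≥0 => fHat T (cumClaims M D Z α ω) t) atTop
      (𝓝 (devFactor ν t)) := by
    intro t ht
    -- All accident years share one claim law, so `∑ λ_j` cancels from the quotient.
    have hlim : devFactor ν t =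
        (∑ j ∈ Finset.Icc 1 (T - t), lam j * claimMoment ν 1 (Set.Iic (t + 1))) /
          ∑ j ∈ Finset.Icc 1 (T - t), lam j * claimMoment ν 1 (Set.Iic t) := by
      have hne := (hpos t ht).ne'
      rw [← Finset.sum_mul] at hne
      rw [← Finset.sum_mul, ← Finset.sum_mul, mul_div_mul_left _ _ (left_ne_zero_of_mul hne)]
      rfl
    rw [hlim]
    refine ((hsum t ht (t + 1)).div (hsum t ht t) (hpos t ht).ne').congr' ?_
    filter_upwards [eventually_gt_atTop 0] with α hα
    have hα' : (α : ℝ) ≠ 0 := by exact_mod_cast hα.ne'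
    exact div_div_div_cancel_right₀ hα' _ _
  intro t ht
  refine ⟨?_, ?_⟩
  · filter_upwards [(hsum t ht t).eventually_ne (hpos t ht).ne'] with α hα h0
    simp [h0] at hα
  · have hnum : Tendsto (fun α : ℝ≥0 => (∏ s ∈ I with s < t, fHat T (cumClaims M D Z α ω) s) *
        ∏ s ∈ I with t < s, devFactor ν s) atTop
        (𝓝 ((∏ s ∈ I with s < t, devFactor ν s) * ∏ s ∈ I with t < s, devFactor ν s)) :=
      (tendsto_finsetProd _ fun s hs => hfhat s (Finset.mem_filter.1 hs).1).mul_const _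
    refine (hnum.div (hsum t ht t) (hpos t ht).ne').congr fun α => ?_
    rw [deltaWeight, Pi.div_apply, div_div_eq_mul_div]
    ring

/-- Asymptotic normality of the product of the estimated development factors, with the
denominators and the exposure kept apart. -/
lemma tendstoInDistribution_sum_deltaWeight (h : GeneralModel P T M D Z ν lam)
    (hI : ∀ t ∈ I, 1 ≤ t ∧ t + 1 ≤ T) :
    TendstoInDistribution
      (fun (α : ℝ≥0) ω => ∑ t ∈ I, ((√(α : ℝ))⁻¹ * ∑ j ∈ Finset.Icc 1 (T - t),
          (cumClaims M D Z α ω j (t + 1) - devFactor ν t * cumClaims M D Z α ω j t)) *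
        ((α : ℝ) * deltaWeight T I (devFactor ν) (cumClaims M D Z α ω) t)) atTop
      (fun x : ℝ =>
        √(∑ j ∈ Finset.Icc 1 T, lam j * ∫ p, influence T I ν lam j p ^ 2 ∂ν) * x)
      (fun _ => P) (gaussianReal 0 1) := by
  have hw := h.ae_tendsto_deltaWeight hI
  have hwm : ∀ t, ∀ α : ℝ≥0, AEMeasurable
      (fun ω => (α : ℝ) * deltaWeight T I (devFactor ν) (cumClaims M D Z α ω) t) P :=
    fun t α => ((h.measurable_deltaWeight α I _ t).const_mul _).aemeasurable
  have hU : ∀ t ∈ I, TendstoInDistribution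
      (fun (α : ℝ≥0) ω => (√(α : ℝ))⁻¹ * ∑ j ∈ Finset.Icc 1 (T - t),
          (cumClaims M D Z α ω j (t + 1) - devFactor ν t * cumClaims M D Z α ω j t)) atTop
      (fun x : ℝ => √(∑ j ∈ Finset.Icc 1 T, lam j *
        ∫ p, (if j ≤ T - t then residual ν t p else 0) ^ 2 ∂ν) * x)
      (fun _ => P) (gaussianReal 0 1) := by
    intro t ht
    simp_rw [← sum_claimSum_ite]
    refine h.tendstoInDistribution_sum_claimSum
      (g := fun j p => if j ≤ T - t then residual ν t p else 0) ?_ ?_ ?_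
    · intro j
      split_ifs
      exacts [measurable_residual ν t, measurable_const]
    · intro j
      split_ifs
      exacts [h.memLp_residual t, MemLp.zero']
    · intro j
      split_ifs
      · exact h.integral_residual (hI t ht).1 (hI t ht).2
      · simp
  refine tendstoInDistribution_of_tendstoInMeasure_sub _ _
    (h.tendstoInDistribution_sum_claimSum (fun j => measurable_influence j)
      (fun j => h.memLp_influence j) (h.integral_influence hI)) ?_ ?_
  -- Slutsky: each scaled residual sum converges in distribution and its weight error tends to `0`,
  -- so the products are negligible.
  · have hz : TendstoInMeasure P (fun (α : ℝ≥0) ω => ∑ t ∈ I,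
        ((√(α : ℝ))⁻¹ * ∑ j ∈ Finset.Icc 1 (T - t),
          (cumClaims M D Z α ω j (t + 1) - devFactor ν t * cumClaims M D Z α ω j t)) *
        ((α : ℝ) * deltaWeight T I (devFactor ν) (cumClaims M D Z α ω) t -
          limitWeight T I ν lam t)) atTop 0 := by
      refine tendstoInMeasure_sum I fun t ht => ?_
      refine tendstoInMeasure_mul_zero (hU t ht) ?_ fun α => (hwm t α).sub_const _
      refine tendstoInMeasure_of_ae_tendsto (fun α => (hwm t α).sub_const _) ?_
      filter_upwards [hw] with ω hω
      simpa using (hω t ht).2.sub_const (limitWeight T I ν lam t)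
    convert hz using 1
    funext α ω
    simp only [Pi.sub_apply, sum_claimSum_influence, sum_claimSum_ite, Finset.mul_sum (s := I),
      ← Finset.sum_sub_distrib]
    refine Finset.sum_congr rfl fun t _ => ?_
    ring
  · intro α
    exact Finset.aemeasurable_fun_sum _ fun t ht => ((hU t ht).forall_aemeasurable α).mul (hwm t α)

/-- The scaled squared error of the product of the estimated development factors converges in
distribution to a multiple of a chi-squared variable. -/
theorem tendstoInDistribution_estimationError (h : GeneralModel P T M D Z ν lam)
    (hI : ∀ t ∈ I, 1 ≤ t ∧ t + 1 ≤ T) {i n : ℕ} (hi : i ∈ Finset.Icc 1 T) (hn : 1 ≤ n)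
    (hnT : n ≤ T) :
    TendstoInDistribution
      (fun (α : ℝ≥0) ω => cumClaims M D Z α ω i n *
        (∏ s ∈ I, devFactor ν s - ∏ s ∈ I, fHat T (cumClaims M D Z α ω) s) ^ 2) atTop
      (fun x : ℝ => √(lam i * claimMoment ν 1 (Set.Iic n) *
        ∑ j ∈ Finset.Icc 1 T, lam j * ∫ p, influence T I ν lam j p ^ 2 ∂ν) ^ 2 * x)
      (fun _ => P) (chiSquared 1) := by
  have hc : 0 ≤ lam i * claimMoment ν 1 (Set.Iic n) :=
    mul_nonneg (h.lam_pos i hi).le (h.claimMoment_Iic_pos hn hnT).le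
  have hv : 0 ≤ ∑ j ∈ Finset.Icc 1 T, lam j * ∫ p, influence T I ν lam j p ^ 2 ∂ν :=
    Finset.sum_nonneg fun j hj => mul_nonneg (h.lam_pos j hj).le
      (integral_nonneg fun p => sq_nonneg _)
  have hY := h.tendstoInDistribution_sum_deltaWeight hI
  have hCm : ∀ α : ℝ≥0, AEMeasurable (fun ω => cumClaims M D Z α ω i n / (α : ℝ)) P :=
    fun α => ((h.measurable_cumClaims hi α n).div_const _).aemeasurable
  have hC : TendstoInMeasure P (fun (α : ℝ≥0) ω => cumClaims M D Z α ω i n / (α : ℝ)) atTop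
      (fun _ => lam i * claimMoment ν 1 (Set.Iic n)) := by
    refine tendstoInMeasure_of_ae_tendsto hCm ?_
    filter_upwards [h.ae_tendsto_cumClaims_div] with ω hω using hω i hi n
  have hG := hY.continuous_comp_prodMk_of_tendstoInMeasure_const
    (g := fun q : ℝ × ℝ => q.2 * q.1 ^ 2) (by fun_prop) hC hCm
  refine tendstoInDistribution_of_map_eq ?_ (by fun_prop)
    (map_sq_gaussianReal_eq_map_chiSquared hc hv)
  have hWm : ∀ α : ℝ≥0, AEMeasurable (fun ω => cumClaims M D Z α ω i n *
      (∏ s ∈ I, devFactor ν s - ∏ s ∈ I, fHat T (cumClaims M D Z α ω) s) ^ 2) P := fun α =>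
    ((h.measurable_cumClaims hi α n).mul (((Finset.measurable_fun_prod _ fun s _ =>
      h.measurable_fHat α s).const_sub _).pow_const 2)).aemeasurable
  refine tendstoInDistribution_of_tendstoInMeasure_sub _ _ hG ?_ hWm
  refine tendstoInMeasure_of_ae_tendsto
    (fun α => (hWm α).sub (hG.forall_aemeasurable α)) ?_
  filter_upwards [h.ae_tendsto_deltaWeight hI] with ω hω
  -- Along almost every path the two expressions eventually coincide: the telescoping is exact once
  -- the denominators are nonzero and `α > 0`.
  refine tendsto_const_nhds.congr' ?_
  have hne := (Filter.eventually_all_finset I).2 fun t ht => (hω t ht).1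
  filter_upwards [hne, eventually_gt_atTop 0] with α hα hpos
  have hα' : (0 : ℝ) < α := by exact_mod_cast hpos
  have hs : (√(α : ℝ)) ^ 2 = α := Real.sq_sqrt hα'.le
  have hs0 : √(α : ℝ) ≠ 0 := (Real.sqrt_pos.2 hα').ne'
  have hsum : ∑ t ∈ I, ((√(α : ℝ))⁻¹ * ∑ j ∈ Finset.Icc 1 (T - t),
          (cumClaims M D Z α ω j (t + 1) - devFactor ν t * cumClaims M D Z α ω j t)) *
        ((α : ℝ) * deltaWeight T I (devFactor ν) (cumClaims M D Z α ω) t) =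
      √(α : ℝ) * (∏ s ∈ I, fHat T (cumClaims M D Z α ω) s - ∏ s ∈ I, devFactor ν s) := by
    rw [prod_fHat_sub_prod T I (devFactor ν) _ hα, Finset.mul_sum]
    refine Finset.sum_congr rfl fun t _ => ?_
    nth_rewrite 2 [← hs]
    field_simp
  simp only [Pi.sub_apply, Pi.zero_apply, hsum, mul_pow, hs]
  field_simp
  ring

end GeneralModel

/-! ### Nondegeneracy, the variance formula and Mack's estimator -/

lemma claimMoment_eq_mul_of_indepFun {ν : Measure (ℕ × ℝ)}
    (hind : IndepFun (Prod.snd : ℕ × ℝ → ℝ) (Prod.fst : ℕ × ℝ → ℕ) ν) (n : ℕ) (A : Set ℕ) :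
    claimMoment ν n A = (∫ p, p.2 ^ n ∂ν) * ∫ p, A.indicator (fun _ => (1 : ℝ)) p.1 ∂ν := by
  rw [← hind.integral_fun_comp_mul_comp (f := fun z : ℝ => z ^ n)
    (g := A.indicator fun _ => (1 : ℝ)) measurable_snd.aemeasurable measurable_fst.aemeasurable
    (by fun_prop) (Measurable.of_discrete).aestronglyMeasurable]
  refine integral_congr_ae (ae_of_all _ fun p => ?_)
  by_cases hp : p.1 ∈ A <;> simp [hp]

/-- Plugging the estimates into the variance formula gives Mack's estimation error. -/
lemma mul_gammaSqFormula_eq_mackEstimationError (T i : ℕ) (c : ℕ → ℕ → ℝ) (last : ℝ) {a : ℝ}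
    (ha : a ≠ 0) :
    c i (T - i + 1) * gammaSqFormula T i (fun j t => a⁻¹ * c j t) (fHat T c)
      (sigmaHatSq T c last) = mackEstimationError T c last i := by
  unfold gammaSqFormula mackEstimationError ultimatePredictor
  rw [mul_pow, ← Finset.prod_pow, Finset.mul_sum, Finset.mul_sum, Finset.mul_sum]
  -- The factor `a⁻¹` occurs once in front and once in each denominator. With division by zero equal
  -- to `0`, the identity needs no nonvanishing of claims or factors.
  refine Finset.sum_congr rfl fun t _ => ?_
  rw [← Finset.mul_sum, ← div_div, div_eq_mul_inv _ a⁻¹, inv_inv, mul_one_div]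
  field_simp

lemma prod_filter_lt_mul_prod_filter_gt (I : Finset ℕ) (f : ℕ → ℝ) {t : ℕ} (ht : t ∈ I)
    (hf : f t ≠ 0) :
    (∏ s ∈ I with s < t, f s) * ∏ s ∈ I with t < s, f s = (∏ s ∈ I, f s) / f t := by
  rw [eq_div_iff hf, ← Finset.mul_prod_erase I f ht, mul_comm (f t)]
  congr 1
  rw [← Finset.prod_union]
  · refine Finset.prod_congr ?_ fun _ _ => rfl
    ext s
    simp only [Finset.mem_union, Finset.mem_filter, Finset.mem_erase]
    have : s ≠ t ↔ s < t ∨ t < s := ne_iff_lt_or_gt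
    tauto
  · refine Finset.disjoint_filter.2 fun s _ h1 h2 => lt_asymm h1 h2

namespace GeneralModel

variable {Ω : Type*} [MeasurableSpace Ω] {P : Measure Ω} [IsProbabilityMeasure P] {T : ℕ}
  {M : ℕ → ℝ≥0 → Ω → ℕ} {D : ℕ → ℕ → Ω → ℕ} {Z : ℕ → ℕ → Ω → ℝ}
  {ν : Measure (ℕ × ℝ)} {lam : ℕ → ℝ} {I : Finset ℕ}

lemma limitWeight_pos (h : GeneralModel P T M D Z ν lam) (hI : ∀ t ∈ I, 1 ≤ t ∧ t + 1 ≤ T)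
    {t : ℕ} (ht : t ∈ I) : 0 < limitWeight T I ν lam t := by
  have hf : ∀ s ∈ I, 0 < devFactor ν s := fun s hs => h.devFactor_pos (hI s hs).1 (hI s hs).2
  refine div_pos (mul_pos ?_ ?_) (h.sum_lam_mul_pos (hI t ht).1 (hI t ht).2)
  all_goals exact Finset.prod_pos fun s hs => hf s (Finset.mem_filter.1 hs).1

/-- The claims of the first accident year that are reported in the last development year keep the
limit from being degenerate. -/
lemma integral_influence_sq_pos (h : GeneralModel P T M D Z ν lam)
    (hI : ∀ t ∈ I, 1 ≤ t ∧ t + 1 ≤ T) (hlast : T - 1 ∈ I) :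
    0 < ∫ p, influence T I ν lam 1 p ^ 2 ∂ν := by
  have hT := hI _ hlast
  refine lt_of_le_of_ne (integral_nonneg fun p => sq_nonneg _) fun hzero => ?_
  have hae := (integral_eq_zero_iff_of_nonneg (fun p => sq_nonneg _)
    (h.memLp_influence 1).integrable_sq).1 hzero.symm
  refine (h.mean_pos T (by simp; omega)).ne' (integral_eq_zero_of_ae ?_)
  filter_upwards [hae] with p hp
  by_cases hpT : p.1 = T
  -- On `{D = T}` all payments up to a year before `T` vanish, so only the residual of `t = T - 1`
  -- survives, and it equals `Z`.
  · have hinf : influence T I ν lam 1 p = limitWeight T I ν lam (T - 1) * p.2 := by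
      unfold influence
      rw [Finset.sum_eq_single_of_mem _ hlast]
      · rw [if_pos (by omega)]
        simp [residual, payment, hpT, show T ≤ T - 1 + 1 by omega, show ¬ T ≤ T - 1 by omega]
      · intro t ht htT
        have := hI t ht
        simp [residual, payment, hpT, show ¬ T ≤ t + 1 by omega, show ¬ T ≤ t by omega]
    have hp0 : influence T I ν lam 1 p = 0 := by simpa using hp
    rw [hinf] at hp0
    have hp2 : p.2 = 0 := (mul_eq_zero.1 hp0).resolve_left (h.limitWeight_pos hI hlast).ne'
    simp [hp2]
  · simp [hpT]

lemma sum_integral_influence_sq_pos (h : GeneralModel P T M D Z ν lam)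
    (hI : ∀ t ∈ I, 1 ≤ t ∧ t + 1 ≤ T) (hlast : T - 1 ∈ I) :
    0 < ∑ j ∈ Finset.Icc 1 T, lam j * ∫ p, influence T I ν lam j p ^ 2 ∂ν := by
  have hT := hI _ hlast
  refine Finset.sum_pos' (fun j hj => mul_nonneg (h.lam_pos j hj).le
    (integral_nonneg fun p => sq_nonneg _)) ⟨1, by simp; omega, ?_⟩
  exact mul_pos (h.lam_pos 1 (by simp; omega)) (h.integral_influence_sq_pos hI hlast)

omit [IsProbabilityMeasure P] in
lemma integral_residual_mul (h : GeneralModel P T M D Z ν lam) (s t : ℕ) :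
    ∫ p, residual ν s p * residual ν t p ∂ν =
      claimMoment ν 2 (Set.Iic (min (s + 1) (t + 1))) -
        devFactor ν t * claimMoment ν 2 (Set.Iic (min (s + 1) t)) -
        devFactor ν s * claimMoment ν 2 (Set.Iic (min s (t + 1))) +
        devFactor ν s * devFactor ν t * claimMoment ν 2 (Set.Iic (min s t)) := by
  have hi : ∀ n, Integrable (fun p => payment n p ^ 2) ν := fun n => (h.memLp_payment n).integrable_sq
  have hpt : ∀ p, residual ν s p * residual ν t p =
      payment (min (s + 1) (t + 1)) p ^ 2 - devFactor ν t * payment (min (s + 1) t) p ^ 2 -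
        devFactor ν s * payment (min s (t + 1)) p ^ 2 +
        devFactor ν s * devFactor ν t * payment (min s t) p ^ 2 := by
    intro p
    simp only [residual, ← payment_mul_payment]
    ring
  simp_rw [hpt]
  rw [integral_add (by fun_prop) (by fun_prop), integral_sub (by fun_prop) (by fun_prop),
    integral_sub (by fun_prop) (by fun_prop)]
  simp only [integral_const_mul, claimMoment_two_Iic]

/-- The variance of the residual is `σ_t ^ 2 * E[Z 1{D ≤ t}]`. -/
lemma integral_residual_sq (h : GeneralModel P T M D Z ν lam) {t : ℕ} (h1 : 1 ≤ t)
    (hT : t + 1 ≤ T) :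
    ∫ p, residual ν t p * residual ν t p ∂ν =
      sigmaSq ν t * claimMoment ν 1 (Set.Iic t) := by
  have hm := (h.claimMoment_Iic_pos h1 (by omega)).ne'
  have hd := (h.mean_pos (t + 1) (by simp [hT])).ne'
  have e1 := claimMoment_Iic_succ (h.integrable_pow (by omega) one_le_two) t
  have e2 := claimMoment_Iic_succ (h.integrable_pow (by omega) le_rfl) t
  -- This turns the quotients in `σ_t ^ 2` back into second moments.
  have hf : (devFactor ν t - 1) * claimMoment ν 1 (Set.Iic t) = claimMoment ν 1 {t + 1} := by
    rw [devFactor, e1]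
    field_simp
    ring
  rw [h.integral_residual_mul]
  simp only [min_self, show min (t + 1) t = t by omega, show min t (t + 1) = t by omega, e2]
  have hs : sigmaSq ν t * claimMoment ν 1 (Set.Iic t) =
      ((devFactor ν t - 1) * claimMoment ν 1 (Set.Iic t)) *
          (claimMoment ν 2 {t + 1} / claimMoment ν 1 {t + 1}) +
        (devFactor ν t - 1) ^ 2 * claimMoment ν 2 (Set.Iic t) := by
    unfold sigmaSq
    field_simp
  rw [hs, hf]
  field_simp
  ring

/-- If sizes and development years are independent, the residuals of different development years
are uncorrelated. -/
lemma integral_residual_mul_eq_zero (h : GeneralModel P T M D Z ν lam)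
    (hind : IndepFun (Prod.snd : ℕ × ℝ → ℝ) (Prod.fst : ℕ × ℝ → ℕ) ν) {s t : ℕ}
    (hs : 1 ≤ s) (hst : s < t) (hT : t + 1 ≤ T) :
    ∫ p, residual ν s p * residual ν t p ∂ν = 0 := by
  have hm := (h.claimMoment_Iic_pos hs (by omega)).ne'
  rw [h.integral_residual_mul]
  simp only [show min (s + 1) (t + 1) = s + 1 by omega, show min (s + 1) t = s + 1 by omega,
    show min s (t + 1) = s by omega, show min s t = s by omega]
  -- Under independence `f_s` is the ratio `P(D ≤ s + 1) / P(D ≤ s)`, whichever power of `Z` is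
  -- weighted. The covariance is `(1 - f_t)` times the difference of the two sides.
  have hprop : claimMoment ν 2 (Set.Iic (s + 1)) = devFactor ν s * claimMoment ν 2 (Set.Iic s) := by
    have e := claimMoment_eq_mul_of_indepFun hind
    unfold devFactor
    rw [e 1] at hm
    rw [e 2, e 2, e 1, e 1]
    have := left_ne_zero_of_mul hm
    have := right_ne_zero_of_mul hm
    rw [mul_div_mul_left _ _ (left_ne_zero_of_mul hm)]
    field_simp
  rw [hprop]
  ring

lemma integral_influence_sq (h : GeneralModel P T M D Z ν lam)
    (hind : IndepFun (Prod.snd : ℕ × ℝ → ℝ) (Prod.fst : ℕ × ℝ → ℕ) ν)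
    (hI : ∀ t ∈ I, 1 ≤ t ∧ t + 1 ≤ T) (j : ℕ) :
    ∫ p, influence T I ν lam j p ^ 2 ∂ν =
      ∑ t ∈ I, if j ≤ T - t then
        limitWeight T I ν lam t ^ 2 * (sigmaSq ν t * claimMoment ν 1 (Set.Iic t)) else 0 := by
  have hmul : ∀ s t, Integrable (fun p => residual ν s p * residual ν t p) ν :=
    fun s t => (h.memLp_residual s).integrable_mul (h.memLp_residual t)
  have hexp : ∀ p, influence T I ν lam j p ^ 2 = ∑ s ∈ I, ∑ t ∈ I,
      (limitWeight T I ν lam s * (if j ≤ T - s then 1 else 0) *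
        (limitWeight T I ν lam t * (if j ≤ T - t then 1 else 0))) *
        (residual ν s p * residual ν t p) := by
    intro p
    rw [sq, influence, Finset.sum_mul_sum]
    refine Finset.sum_congr rfl fun s _ => Finset.sum_congr rfl fun t _ => ?_
    split_ifs <;> ring
  simp_rw [hexp]
  rw [integral_finsetSum _ fun s _ => integrable_finsetSum _ fun t _ => (hmul s t).const_mul _]
  refine Finset.sum_congr rfl fun s hs => ?_
  rw [integral_finsetSum _ fun t _ => (hmul s t).const_mul _, Finset.sum_eq_single_of_mem s hs]
  · rw [integral_const_mul, h.integral_residual_sq (hI s hs).1 (hI s hs).2]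
    split_ifs <;> ring
  · intro t ht hts
    rw [integral_const_mul]
    rcases lt_or_gt_of_ne hts with hlt | hlt
    · simp_rw [mul_comm (residual ν s _)]
      rw [h.integral_residual_mul_eq_zero hind (hI t ht).1 hlt (hI s hs).2, mul_zero]
    · rw [h.integral_residual_mul_eq_zero hind (hI s hs).1 hlt (hI t ht).2, mul_zero]

/-- Summing `λ_j` over `j ≤ T - t` cancels one of the two factors `∑ λ_j` in the denominator of
`limitWeight ^ 2`; the moment in the residual variance cancels one of the two factors `E[Z 1{D ≤
t}]`. -/
lemma sum_integral_influence_sq (h : GeneralModel P T M D Z ν lam)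
    (hind : IndepFun (Prod.snd : ℕ × ℝ → ℝ) (Prod.fst : ℕ × ℝ → ℕ) ν)
    (hI : ∀ t ∈ I, 1 ≤ t ∧ t + 1 ≤ T) :
    ∑ j ∈ Finset.Icc 1 T, lam j * ∫ p, influence T I ν lam j p ^ 2 ∂ν =
      (∏ s ∈ I, devFactor ν s ^ 2) * ∑ t ∈ I, (sigmaSq ν t / devFactor ν t ^ 2) /
        ∑ j ∈ Finset.Icc 1 (T - t), lam j * claimMoment ν 1 (Set.Iic t) := by
  simp_rw [h.integral_influence_sq hind hI, Finset.mul_sum]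
  rw [Finset.sum_comm]
  refine Finset.sum_congr rfl fun t ht => ?_
  have hf := (h.devFactor_pos (hI t ht).1 (hI t ht).2).ne'
  have hL := (h.sum_lam_mul_pos (hI t ht).1 (hI t ht).2).ne'
  have hsum : ∀ x : ℝ, ∑ j ∈ Finset.Icc 1 T, lam j * (if j ≤ T - t then x else 0) =
      (∑ j ∈ Finset.Icc 1 (T - t), lam j) * x := by
    intro x
    have hfil : (Finset.Icc 1 T).filter (· ≤ T - t) = Finset.Icc 1 (T - t) := by
      ext j
      simp only [Finset.mem_filter, Finset.mem_Icc]
      omega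
    simp_rw [mul_ite, mul_zero]
    rw [← Finset.sum_filter, hfil, Finset.sum_mul]
  rw [hsum, limitWeight, prod_filter_lt_mul_prod_filter_gt I _ ht hf, Finset.prod_pow]
  rw [← Finset.sum_mul] at hL ⊢
  have h1 := left_ne_zero_of_mul hL
  have h2 := right_ne_zero_of_mul hL
  field_simp

end GeneralModel

end ChainLadder

end

theorem mainTheorem2 {Ω : Type*} [MeasurableSpace Ω] (P : Measure Ω) [IsProbabilityMeasure P]
    (T : ℕ) (M : ℕ → ℝ≥0 → Ω → ℕ) (D : ℕ → ℕ → Ω → ℕ) (Z : ℕ → ℕ → Ω → ℝ)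
    (ν : Measure (ℕ × ℝ)) (lam : ℕ → ℝ)
    (hmodel : ChainLadder.GeneralModel P T M D Z ν lam)
    (i : ℕ) (hi : 2 ≤ i) (hiT : i ≤ T) :
    (∃ γ : ℝ, 0 < γ ∧
      TendstoInDistribution
        (fun (α : ℝ≥0) (ω : Ω) =>
          ChainLadder.cumClaims M D Z α ω i (T - i + 1) *
            ((∏ s ∈ Finset.Icc (T - i + 1) (T - 1), ChainLadder.devFactor ν s) -
              (∏ s ∈ Finset.Icc (T - i + 1) (T - 1),
                ChainLadder.fHat T (ChainLadder.cumClaims M D Z α ω) s)) ^ 2)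
        atTop (fun x : ℝ => γ ^ 2 * x) (fun _ => P) (ChainLadder.chiSquared 1) ∧
      (IndepFun (Prod.snd : ℕ × ℝ → ℝ) (Prod.fst : ℕ × ℝ → ℕ) ν →
        γ ^ 2 = ChainLadder.gammaSqFormula T i
          (fun j t => lam j * ChainLadder.claimMoment ν 1 (Set.Iic t))
          (ChainLadder.devFactor ν) (ChainLadder.sigmaSq ν))) ∧
    (∀ (α : ℝ≥0), 0 < α → ∀ (ω : Ω) (last : ℝ),
      ChainLadder.cumClaims M D Z α ω i (T - i + 1) *
          ChainLadder.gammaSqFormula T i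
            (fun j t => (α : ℝ)⁻¹ * ChainLadder.cumClaims M D Z α ω j t)
            (ChainLadder.fHat T (ChainLadder.cumClaims M D Z α ω))
            (ChainLadder.sigmaHatSq T (ChainLadder.cumClaims M D Z α ω) last) =
        ChainLadder.mackEstimationError T (ChainLadder.cumClaims M D Z α ω) last i) := by
  have hI : ∀ t ∈ Finset.Icc (T - i + 1) (T - 1), 1 ≤ t ∧ t + 1 ≤ T := by
    intro t ht
    rw [Finset.mem_Icc] at ht
    omega
  have hlast : T - 1 ∈ Finset.Icc (T - i + 1) (T - 1) := by
    rw [Finset.mem_Icc]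
    omega
  have hi' : i ∈ Finset.Icc 1 T := by
    rw [Finset.mem_Icc]
    omega
  -- The witness `γ` is the square root of this product. Its last factor is positive because `i ≥ 2`
  -- puts `T - 1` into the range of development years.
  have hpos := mul_pos (mul_pos (hmodel.lam_pos i hi')
    (hmodel.claimMoment_Iic_pos (t := T - i + 1) (by omega) (by omega)))
    (hmodel.sum_integral_influence_sq_pos hI hlast)
  refine ⟨⟨_, Real.sqrt_pos.2 hpos, hmodel.tendstoInDistribution_estimationError hI hi' (by omega)
    (by omega), fun hind => ?_⟩, fun α hα ω last =>
    ChainLadder.mul_gammaSqFormula_eq_mackEstimationError T i _ last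
      (by exact_mod_cast hα.ne')⟩
  rw [Real.sq_sqrt hpos.le, hmodel.sum_integral_influence_sq hind hI, ChainLadder.gammaSqFormula]
  ring
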